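/- Let $2\le k\le n$ be integers. For $\gamma\in\mathbb R^n$ let $\sigma_j(\gamma)=\sum_{i_1<\dots<i_j}\gamma_{i_1}\cdots\gamma_{i_j}$ be the $j$-th elementary symmetric polynomial, and let $\sigma_{k-1,i}(\gamma)$ be $\sigma_{k-1}$ evaluated at $\gamma$ with its $i$-th entry replaced by $0$. Let $\Gamma_k=\{\gamma\in\mathbb R^n:\sigma_j(\gamma)>0 \text{ for } j=1,\dots,k\}$, and let $\overline\Gamma_k$ be its closure in $\mathbb R^n$. For a real symmetric $n\times n$ matrix $M$ let $\lambda(M)=(\lambda_1(M),\dots,\lambda_n(M))$ be its eigenvalues with multiplicity (the order plays no role below). Let $\mathcal A_k$ be the set of real symmetric positive semidefinite $n\times n$ matrices $A$ for which there is $\gamma\in\Gamma_k$ with $\sigma_k(\gamma)=1$ and $\lambda_i(A)^2=\sigma_{k-1,i}(\gamma)$ for $i=1,\dots,n$. Then, for every real symmetric $n\times n$ matrix $M$, $$\inf_{A\in\mathcal A_k}\operatorname{tr}(A^tMA)=\begin{cases}k\,\sigma_k(\lambda(M))^{1/k}&\text{if }\lambda(M)\in\overline\Gamma_k,\\-\infty&\text{otherwise.}\end{cases}$$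 Consequently, the set of real symmetric matrices $M$ with $\inf_{A\in\mathcal A_k}\operatorname{tr}(A^tMA)>-\infty$ is exactly the set of those with $\lambda(M)\in\overline\Gamma_k$; and for every open $\Omega\subseteq\mathbb R^n$ and every $u\in C^2(\Omega)$, $u$ is $k$-convex (that is, $\sigma_j(\lambda(D^2u(x)))\ge0$ for all $j=1,\dots,k$ and all $x\in\Omega$) if and only if $u$ is $\mathcal A_k$-admissible (that is, $\inf_{A\in\mathcal A_k}\operatorname{tr}(A^tD^2u(x)A)>-\infty$ for all $x\in\Omega$). -/

import Mathlib

noncomputable section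

namespace KHessian

/-- The `k`-th elementary symmetric function of `γ ∈ ℝⁿ`. -/
def sigma {n : ℕ} (k : ℕ) (γ : Fin n → ℝ) : ℝ :=
  MvPolynomial.eval γ (MvPolynomial.esymm (Fin n) ℝ k)

/-- `σ_{k,i}(γ)`: the `k`-th elementary symmetric function of `γ` with its `i`-th entry
replaced by `0`. -/
def sigmaOmit {n : ℕ} (k : ℕ) (i : Fin n) (γ : Fin n → ℝ) : ℝ :=
  sigma k (Function.update γ i 0)

/-- The open Gårding cone `Γ_k ⊆ ℝⁿ`. -/
def gardingCone (n k : ℕ) : Set (Fin n → ℝ) :=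
  {γ | ∀ j : ℕ, 1 ≤ j → j ≤ k → 0 < sigma j γ}

/-- The real symmetric matrices whose eigenvalue vector (counted with multiplicity) lies in the
closed Gårding cone, the topological closure of `Γ_k`. Over `ℝ`, Hermitian means symmetric. The
cone is invariant under permutations, so the order of the eigenvalues is immaterial. -/
def closedConeMat (n k : ℕ) : Set (Matrix (Fin n) (Fin n) ℝ) :=
  {M | ∃ hM : M.IsHermitian, hM.eigenvalues ∈ closure (gardingCone n k)}

/-- The set `𝒜_k` of symmetric positive semidefinite matrices `A` with
`λ_i(A)² = σ_{k-1,i}(γ)` for all `i`, for some `γ ∈ Γ_k` with `σ_k(γ) = 1`. Permuting `γ` permutes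
the numbers `σ_{k-1,i}(γ)`, so the order of the eigenvalues is immaterial. -/
def coeffSet (n k : ℕ) : Set (Matrix (Fin n) (Fin n) ℝ) :=
  {A | ∃ hA : A.PosSemidef, ∃ γ ∈ gardingCone n k, sigma k γ = 1 ∧
    ∀ i, hA.isHermitian.eigenvalues i ^ 2 = sigmaOmit (k - 1) i γ}

/-- `F(M) = inf_{A ∈ 𝒜} tr(Aᵗ M A)`, an infimum in the extended reals. -/
def infOp {n : ℕ} (𝒜 : Set (Matrix (Fin n) (Fin n) ℝ)) (M : Matrix (Fin n) (Fin n) ℝ) : EReal :=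
  ⨅ A ∈ 𝒜, ((A.transpose * M * A).trace : EReal)

/-- `Γ_𝒜 = {M symmetric : F(M) > -∞}`. -/
def finiteCone {n : ℕ} (𝒜 : Set (Matrix (Fin n) (Fin n) ℝ)) : Set (Matrix (Fin n) (Fin n) ℝ) :=
  {M | M.IsHermitian ∧ ⊥ < infOp 𝒜 M}

/-- The Hessian matrix `D²u(x)`, with entries the second partial derivatives. -/
def hessian {n : ℕ} (u : EuclideanSpace ℝ (Fin n) → ℝ) (x : EuclideanSpace ℝ (Fin n)) :
    Matrix (Fin n) (Fin n) ℝ :=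
  Matrix.of fun i j =>
    iteratedFDeriv ℝ 2 u x ![EuclideanSpace.single i 1, EuclideanSpace.single j 1]

/-- `u` is `𝒜`-admissible in `Ω`. -/
def Admissible {n : ℕ} (𝒜 : Set (Matrix (Fin n) (Fin n) ℝ))
    (Ω : Set (EuclideanSpace ℝ (Fin n))) (u : EuclideanSpace ℝ (Fin n) → ℝ) : Prop :=
  ∀ x ∈ Ω, hessian u x ∈ finiteCone 𝒜

/-- `u` is `k`-convex in `Ω`: `σ_j(λ(D²u(x))) ≥ 0` for `j = 1, …, k` and all `x ∈ Ω`. (The Hessian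
of a `C²` function on an open set is symmetric.) -/
def KConvex {n : ℕ} (k : ℕ) (Ω : Set (EuclideanSpace ℝ (Fin n)))
    (u : EuclideanSpace ℝ (Fin n) → ℝ) : Prop :=
  ∀ x ∈ Ω, ∃ h : (hessian u x).IsHermitian,
    ∀ j : ℕ, 1 ≤ j → j ≤ k → 0 ≤ sigma j h.eigenvalues

end KHessian

end

/-! Let `Dσ_k(γ)[y] = ∑ i, y i * σ_{k-1,i}(γ)` be the derivative of `σ_k`. Up to the order of its
entries, `(σ_{k-1,i}(γ))` is the spectrum of `A²` for `A ∈ 𝒜_k`, and `tr(Aᵗ M A)` is the average of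
the pairings of the two spectra against a doubly stochastic matrix. By Birkhoff's theorem the
infimum is therefore that of `Dσ_k(γ)[λ(M)]` over the `γ ∈ Γ_k` with `σ_k(γ) = 1`.

For `λ(M)` in the closed cone, the lower bound is Gårding's inequality. It follows from the
superadditivity of the quotients `r_j = σ_{j+1} / σ_j` on `Γ_k` (Marcus–Lopes, by induction on the
number of entries): the product of `r_0, …, r_{k-1}` is `σ_k`, so `σ_k(x + t y) / σ_k(x)` is at
least the product of the `1 + t r_j(y) / r_j(x)`; differentiate at `t = 0` and use the inequality of
arithmetic and geometric means. Normalizing `λ(M) + ε 1` and letting `ε → 0` shows that the bound is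
sharp.

For `λ(M)` outside the closed cone, some `w` on its boundary satisfies `w ≥ λ(M) + τ 1` with `τ > 0`
and `σ_1(w) > 0`. Let `γ` be the normalization of `w + ε 1`. Then `Dσ_k(γ)[w]` stays bounded, while
`σ_1(γ) → ∞` and Newton's inequalities give `σ_1(γ) ≤ σ_{k-1}(γ) ^ (k - 1)`, so
`Dσ_k(γ)[λ(M)] ≤ Dσ_k(γ)[w] - τ (n - k + 1) σ_{k-1}(γ) → -∞`.
-/

namespace KHessian

open Finset Filter Topology

variable {ι : Type*}

section ElementarySymmetric

variable {R : Type*}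

section CommSemiring

variable [CommSemiring R]

/-- The elementary symmetric function `σ_k` of the entries of `x` indexed by the finite set `s`.
Deleting an index from `s` expresses `σ_{k,i}` without substituting `0` for an entry. -/
def esymm (s : Finset ι) (k : ℕ) (x : ι → R) : R := (s.val.map x).esymm k

lemma esymm_eq_sum (s : Finset ι) (k : ℕ) (x : ι → R) :
    esymm s k x = ∑ t ∈ s.powersetCard k, ∏ i ∈ t, x i :=
  s.esymm_map_val x k

@[simp] lemma esymm_zero (s : Finset ι) (x : ι → R) : esymm s 0 x = 1 := by
  simp [esymm_eq_sum]

@[simp] lemma esymm_one (s : Finset ι) (x : ι → R) : esymm s 1 x = ∑ i ∈ s, x i := by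
  simp [esymm_eq_sum, powersetCard_one]

lemma esymm_of_card_lt {s : Finset ι} {k : ℕ} (h : #s < k) (x : ι → R) : esymm s k x = 0 := by
  simp [esymm_eq_sum, powersetCard_eq_empty.2 h]

@[simp] lemma esymm_empty_succ (k : ℕ) (x : ι → R) : esymm ∅ (k + 1) x = 0 :=
  esymm_of_card_lt (by simp) x

lemma esymm_smul (s : Finset ι) (k : ℕ) (c : R) (x : ι → R) :
    esymm s k (c • x) = c ^ k * esymm s k x := by
  simpa [esymm, Function.comp_def] using ((s.val.map x).pow_smul_esymm c k).symm

lemma esymm_map {κ : Type*} (f : κ ↪ ι) (s : Finset κ) (k : ℕ) (x : ι → R) :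
    esymm (s.map f) k x = esymm s k (x ∘ f) := by
  simp [esymm]

lemma esymm_congr {s : Finset ι} {x y : ι → R} (h : ∀ i ∈ s, x i = y i) (k : ℕ) :
    esymm s k x = esymm s k y := by
  rw [esymm, esymm, Multiset.map_congr rfl h]

variable [DecidableEq ι]

lemma esymm_insert {s : Finset ι} {a : ι} (ha : a ∉ s) (k : ℕ) (x : ι → R) :
    esymm (insert a s) (k + 1) x = esymm s (k + 1) x + x a * esymm s k x := by
  simp [esymm, Multiset.esymm, ha, Multiset.sum_map_mul_left]

lemma esymm_succ_eq_add_erase {s : Finset ι} {i : ι} (hi : i ∈ s) (k : ℕ) (x : ι → R) :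
    esymm s (k + 1) x = esymm (s.erase i) (k + 1) x + x i * esymm (s.erase i) k x := by
  rw [← esymm_insert (notMem_erase i s), insert_erase hi]

/-- The derivative at `x`, in the direction `y`, of the elementary symmetric function of degree
`k + 1`; see `hasDerivAt_esymm`. -/
def esymmDeriv (s : Finset ι) (k : ℕ) (x y : ι → R) : R :=
  ∑ i ∈ s, y i * esymm (s.erase i) k x

lemma esymmDeriv_insert {s : Finset ι} {a : ι} (ha : a ∉ s) (k : ℕ) (x y : ι → R) :
    esymmDeriv (insert a s) (k + 1) x y =
      esymmDeriv s (k + 1) x y + y a * esymm s (k + 1) x + x a * esymmDeriv s k x y := by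
  have herase : ∀ i ∈ s, y i * esymm ((insert a s).erase i) (k + 1) x =
      y i * esymm (s.erase i) (k + 1) x + x a * (y i * esymm (s.erase i) k x) := fun i hi => by
    have hia : a ≠ i := (ne_of_mem_of_not_mem hi ha).symm
    rw [erase_insert_of_ne hia, esymm_insert fun h => ha (mem_of_mem_erase h)]
    ring
  rw [esymmDeriv, sum_insert ha, erase_insert ha, sum_congr rfl herase, sum_add_distrib,
    ← mul_sum, esymmDeriv, esymmDeriv]
  ring

lemma esymmDeriv_self (s : Finset ι) (k : ℕ) (x : ι → R) :
    esymmDeriv s k x x = (k + 1) * esymm s (k + 1) x := by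
  induction s using Finset.induction_on generalizing k with
  | empty => simp [esymmDeriv]
  | insert a s ha ih =>
    cases k with
    | zero => simp [esymmDeriv]
    | succ k =>
      rw [esymmDeriv_insert ha, ih, ih, esymm_insert ha]
      push_cast
      ring

lemma esymmDeriv_smul_left (s : Finset ι) (k : ℕ) (c : R) (x y : ι → R) :
    esymmDeriv s k (c • x) y = c ^ k * esymmDeriv s k x y := by
  simp only [esymmDeriv, esymm_smul, mul_sum, mul_left_comm]

lemma esymmDeriv_smul_right (s : Finset ι) (k : ℕ) (c : R) (x y : ι → R) :
    esymmDeriv s k x (c • y) = c * esymmDeriv s k x y := by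
  simp only [esymmDeriv, Pi.smul_apply, smul_eq_mul, mul_sum, mul_assoc]

end CommSemiring

section CommRing

variable [CommRing R]

lemma sum_sq_eq_esymm (s : Finset ι) (x : ι → R) :
    ∑ i ∈ s, x i ^ 2 = esymm s 1 x ^ 2 - 2 * esymm s 2 x := by
  classical
  have hEuler : ∑ i ∈ s, x i * esymm (s.erase i) 1 x = 2 * esymm s 2 x := by
    rw [← esymmDeriv, esymmDeriv_self, Nat.cast_one, one_add_one_eq_two]
  have herase : ∀ i ∈ s, x i * esymm (s.erase i) 1 x = x i * esymm s 1 x - x i ^ 2 :=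
    fun i hi => by
      rw [esymm_succ_eq_add_erase hi, esymm_zero]
      ring
  rw [← hEuler, sum_congr rfl herase, sum_sub_distrib, ← sum_mul, ← esymm_one s x]
  ring

variable [DecidableEq ι]

lemma esymmDeriv_sub_right (s : Finset ι) (k : ℕ) (x y z : ι → R) :
    esymmDeriv s k x (y - z) = esymmDeriv s k x y - esymmDeriv s k x z := by
  simp only [esymmDeriv, Pi.sub_apply, sub_mul, sum_sub_distrib]

lemma esymmDeriv_one (s : Finset ι) (k : ℕ) (x : ι → R) :
    esymmDeriv s k x 1 = (#s - k) * esymm s k x := by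
  cases k with
  | zero => simp [esymmDeriv]
  | succ k =>
    have herase : ∀ i ∈ s, (1 : ι → R) i * esymm (s.erase i) (k + 1) x =
        esymm s (k + 1) x - x i * esymm (s.erase i) k x := fun i hi => by
      rw [esymm_succ_eq_add_erase hi, Pi.one_apply]
      ring
    rw [esymmDeriv, sum_congr rfl herase, sum_sub_distrib, ← esymmDeriv, esymmDeriv_self,
      sum_const, nsmul_eq_mul]
    push_cast
    ring

end CommRing

lemma continuous_esymm (s : Finset ι) (k : ℕ) : Continuous (esymm s k : (ι → ℝ) → ℝ) := by
  simp only [funext (esymm_eq_sum s k)]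
  fun_prop

lemma esymm_nonneg {s : Finset ι} {x : ι → ℝ} (hx : ∀ i ∈ s, 0 ≤ x i) (k : ℕ) :
    0 ≤ esymm s k x := by
  rw [esymm_eq_sum]
  exact sum_nonneg fun t ht => prod_nonneg fun i hi => hx i ((mem_powersetCard.1 ht).1 hi)

lemma hasDerivAt_esymm [DecidableEq ι] (s : Finset ι) (k : ℕ) (x y : ι → ℝ) (t : ℝ) :
    HasDerivAt (fun t : ℝ => esymm s (k + 1) (x + t • y)) (esymmDeriv s k (x + t • y) y) t := by
  induction s using Finset.induction_on generalizing k with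
  | empty => simpa [esymmDeriv] using hasDerivAt_const t (0 : ℝ)
  | insert a s ha ih =>
    have hentry : HasDerivAt (fun t : ℝ => (x + t • y) a) (y a) t := by
      simpa using ((hasDerivAt_id t).mul_const (y a)).const_add (x a)
    simp only [esymm_insert ha]
    cases k with
    | zero =>
      simp only [esymm_zero, mul_one]
      refine ((ih 0).add hentry).congr_deriv ?_
      simp [esymmDeriv, sum_insert ha, add_comm]
    | succ k =>
      refine ((ih (k + 1)).add (hentry.mul (ih k))).congr_deriv ?_
      rw [esymmDeriv_insert ha]
      ring

end ElementarySymmetric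

section Newton

open Polynomial

lemma splits_derivative {p : ℝ[X]} (hp : p.Splits) : (derivative p).Splits := by
  rw [splits_iff_card_roots] at hp ⊢
  have hRolle := card_roots_le_derivative p
  have hdeg := natDegree_derivative_le p
  have hcard := card_roots' (derivative p)
  omega

lemma two_mul_coeff_zero_mul_coeff_two_le_sq {p : ℝ[X]} (hp : p.Splits) :
    2 * (p.coeff 0 * p.coeff 2) ≤ p.coeff 1 ^ 2 := by
  have hmonic (s : Multiset ℝ) : 2 * (((s.map fun a => X - C a).prod).coeff 0 *
      ((s.map fun a => X - C a).prod).coeff 2) ≤ ((s.map fun a => X - C a).prod).coeff 1 ^ 2 := by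
    induction s using Multiset.induction_on with
    | empty => simp [coeff_one]
    | cons a s ih =>
      simp only [Multiset.map_cons, Multiset.prod_cons]
      set q := (s.map fun a => X - C a).prod
      have hX₁ : (X * q).coeff 1 = q.coeff 0 := coeff_X_mul q 0
      have hX₂ : (X * q).coeff 2 = q.coeff 1 := coeff_X_mul q 1
      simp only [sub_mul, coeff_sub, coeff_C_mul, coeff_X_mul_zero, hX₁, hX₂]
      nlinarith [sq_nonneg (q.coeff 0), mul_le_mul_of_nonneg_left ih (sq_nonneg a)]
  rw [hp.eq_prod_roots]
  simp only [coeff_C_mul]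
  nlinarith [mul_le_mul_of_nonneg_left (hmonic p.roots) (sq_nonneg p.leadingCoeff)]

lemma newton_coeff {p : ℝ[X]} (hp : p.Splits) (m : ℕ) :
    (m + 2) * (p.coeff m * p.coeff (m + 2)) ≤ (m + 1) * p.coeff (m + 1) ^ 2 := by
  induction m generalizing p with
  | zero => simpa using two_mul_coeff_zero_mul_coeff_two_le_sq hp
  | succ m ih =>
    have h := ih (splits_derivative hp)
    simp only [coeff_derivative] at h
    push_cast at h ⊢
    refine le_of_mul_le_mul_left ?_ (show (0 : ℝ) < (m + 1) * (m + 2) by positivity)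
    linarith

lemma coeff_mul_coeff_le_sq {p : ℝ[X]} (hp : p.Splits) (m : ℕ) :
    p.coeff m * p.coeff (m + 2) ≤ p.coeff (m + 1) ^ 2 := by
  refine le_of_mul_le_mul_left ((newton_coeff hp m).trans ?_) (show (0 : ℝ) < m + 2 by positivity)
  gcongr
  norm_num

lemma esymm_mul_esymm_le_sq (s : Finset ι) (k : ℕ) (x : ι → ℝ) :
    esymm s k x * esymm s (k + 2) x ≤ esymm s (k + 1) x ^ 2 := by
  rcases lt_or_ge #s (k + 2) with hk | hk
  · rw [esymm_of_card_lt hk, mul_zero]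
    exact sq_nonneg _
  · obtain ⟨m, hm⟩ := Nat.exists_eq_add_of_le hk
    have hcoeff (i j : ℕ) (hij : i + j = #s) :
        (∏ i ∈ s, (X + C (x i))).coeff i = esymm s j x := by
      rw [prod_X_add_C_coeff s x (by omega), esymm_eq_sum, ← hij, Nat.add_sub_cancel_left]
    have h := coeff_mul_coeff_le_sq (Splits.prod fun i (_ : i ∈ s) => Splits.X_add_C (x i)) m
    rwa [hcoeff m (k + 2) (by omega), hcoeff (m + 1) (k + 1) (by omega),
      hcoeff (m + 2) k (by omega), mul_comm] at h

end Newton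

section Cones

/-- The open Gårding cone `Γ_k` of the vectors with entries indexed by `s`. The condition at
`j = 0` is `0 < 1`. -/
def posCone (s : Finset ι) (k : ℕ) : Set (ι → ℝ) := {x | ∀ j ≤ k, 0 < esymm s j x}

/-- The closed counterpart of `posCone`; it is the closure of the latter when `k ≤ #s`, see
`closure_posCone`. -/
def nonnegCone (s : Finset ι) (k : ℕ) : Set (ι → ℝ) := {x | ∀ j ≤ k, 0 ≤ esymm s j x}

variable {s : Finset ι} {k : ℕ} {x y : ι → ℝ}

lemma posCone_anti (s : Finset ι) : Antitone (posCone s) :=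
  fun _ _ hkl _ hx j hj => hx j (hj.trans hkl)

lemma nonnegCone_anti (s : Finset ι) : Antitone (nonnegCone s) :=
  fun _ _ hkl _ hx j hj => hx j (hj.trans hkl)

lemma mem_posCone_succ :
    x ∈ posCone s (k + 1) ↔ x ∈ posCone s k ∧ 0 < esymm s (k + 1) x := by
  simp only [posCone, Set.mem_ofPred_eq, Nat.le_succ_iff, or_imp, forall_and, forall_eq]

lemma posCone_subset_nonnegCone (s : Finset ι) (k : ℕ) : posCone s k ⊆ nonnegCone s k :=
  fun _ hx j hj => (hx j hj).le

lemma smul_mem_posCone (hx : x ∈ posCone s k) {c : ℝ} (hc : 0 < c) : c • x ∈ posCone s k :=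
  fun j hj => by
    rw [esymm_smul]
    exact mul_pos (pow_pos hc j) (hx j hj)

lemma isOpen_posCone (s : Finset ι) (k : ℕ) : IsOpen (posCone s k) := by
  simp only [posCone, Set.ofPred_forall]
  exact (Set.finite_Iic k).isOpen_biInter fun j _ =>
    isOpen_lt continuous_const (continuous_esymm s j)

lemma isClosed_nonnegCone (s : Finset ι) (k : ℕ) : IsClosed (nonnegCone s k) := by
  simp only [nonnegCone, Set.ofPred_forall]
  exact isClosed_biInter fun j _ => isClosed_le continuous_const (continuous_esymm s j)

/-- The quotient `σ_{k+1} / σ_k`, considered on `posCone s k`, where it is superadditive; elsewhere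
the denominator may vanish and the value is then `0`. -/
noncomputable def esymmRatio (s : Finset ι) (k : ℕ) (x : ι → ℝ) : ℝ :=
  esymm s (k + 1) x / esymm s k x

lemma esymmRatio_pos (hx : x ∈ posCone s k) {j : ℕ} (hj : j < k) : 0 < esymmRatio s j x :=
  div_pos (hx _ hj) (hx _ hj.le)

lemma esymmRatio_smul (s : Finset ι) (k : ℕ) {c : ℝ} (hc : c ≠ 0) (x : ι → ℝ) :
    esymmRatio s k (c • x) = c * esymmRatio s k x := by
  rw [esymmRatio, esymm_smul, esymm_smul, pow_succ, mul_assoc,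
    mul_div_mul_left _ _ (pow_ne_zero k hc), mul_div_assoc, esymmRatio]

lemma prod_esymmRatio (hx : x ∈ posCone s k) :
    ∏ j ∈ range k, esymmRatio s j x = esymm s k x := by
  induction k with
  | zero => simp
  | succ k ih =>
    rw [prod_range_succ, ih (posCone_anti s k.le_succ hx), esymmRatio,
      mul_div_cancel₀ _ (hx k k.le_succ).ne']

section

variable [DecidableEq ι]

lemma mem_posCone_erase (hx : x ∈ posCone s (k + 1)) {i : ι} (hi : i ∈ s) :
    x ∈ posCone (s.erase i) k := by
  intro j
  induction j with
  | zero => simp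
  | succ j ih =>
    intro hj
    have hpred : 0 < esymm (s.erase i) j x := ih (by omega)
    have hxj := hx (j + 1) (by omega)
    have hxj' := hx (j + 2) (by omega)
    rw [esymm_succ_eq_add_erase hi] at hxj hxj'
    have hNewton := esymm_mul_esymm_le_sq (s.erase i) j x
    by_contra! hneg
    nlinarith [mul_pos hpred hxj', mul_nonneg (neg_nonneg.2 hneg) hxj.le]

lemma add_esymmRatio_erase (hx : x ∈ posCone s (k + 1)) {i : ι} (hi : i ∈ s) :
    x i + esymmRatio (s.erase i) k x = esymm s (k + 1) x / esymm (s.erase i) k x := by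
  have hpos := mem_posCone_erase hx hi k le_rfl
  rw [esymmRatio, esymm_succ_eq_add_erase hi]
  field_simp
  ring

lemma add_esymmRatio_erase_pos (hx : x ∈ posCone s (k + 1)) {i : ι} (hi : i ∈ s) :
    0 < x i + esymmRatio (s.erase i) k x := by
  rw [add_esymmRatio_erase hx hi]
  exact div_pos (hx _ le_rfl) (mem_posCone_erase hx hi k le_rfl)

lemma mul_esymmRatio_succ (hx : x ∈ posCone s (k + 1)) :
    (k + 2) * esymmRatio s (k + 1) x =
      ∑ i ∈ s, (x i - x i ^ 2 / (x i + esymmRatio (s.erase i) k x)) := by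
  have hpos := hx (k + 1) le_rfl
  have hEuler : (k + 2) * esymmRatio s (k + 1) x =
      esymmDeriv s (k + 1) x x / esymm s (k + 1) x := by
    rw [esymmDeriv_self, esymmRatio]
    push_cast
    ring
  rw [hEuler, esymmDeriv, sum_div]
  refine sum_congr rfl fun i hi => ?_
  have herase : esymm (s.erase i) (k + 1) x = esymm s (k + 1) x - x i * esymm (s.erase i) k x :=
    eq_sub_of_add_eq (esymm_succ_eq_add_erase hi k x).symm
  rw [add_esymmRatio_erase hx hi, herase]
  field_simp

end

lemma add_sq_div_le {a b u v w : ℝ} (hu : 0 < u) (hv : 0 < v) (hw : u + v ≤ w) :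
    (a + b) ^ 2 / w ≤ a ^ 2 / u + b ^ 2 / v := by
  have hTitu : (a + b) ^ 2 / (u + v) ≤ a ^ 2 / u + b ^ 2 / v := by
    simpa [Fin.forall_fin_two, hu, hv] using
      sq_sum_div_le_sum_sq_div univ ![a, b] (g := ![u, v])
  exact (by gcongr : (a + b) ^ 2 / w ≤ (a + b) ^ 2 / (u + v)).trans hTitu

/-- The **Marcus–Lopes inequality**. -/
lemma esymmRatio_add_le (hx : x ∈ posCone s k) (hy : y ∈ posCone s k) (hxy : x + y ∈ posCone s k) :
    esymmRatio s k x + esymmRatio s k y ≤ esymmRatio s k (x + y) := by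
  classical
  induction k generalizing s with
  | zero => simp [esymmRatio, sum_add_distrib]
  | succ k ih =>
    have hk : (0 : ℝ) < k + 2 := by positivity
    refine le_of_mul_le_mul_left ?_ hk
    rw [mul_add, mul_esymmRatio_succ hx, mul_esymmRatio_succ hy, mul_esymmRatio_succ hxy,
      ← sum_add_distrib]
    refine sum_le_sum fun i hi => ?_
    have hratio := ih (mem_posCone_erase hx hi) (mem_posCone_erase hy hi)
      (mem_posCone_erase hxy hi)
    have hdiv := add_sq_div_le (a := x i) (b := y i) (add_esymmRatio_erase_pos hx hi)
      (add_esymmRatio_erase_pos hy hi)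
      (w := x i + y i + esymmRatio (s.erase i) k (x + y)) (by linarith)
    simp only [Pi.add_apply]
    linarith

lemma add_mem_posCone (hx : x ∈ posCone s k) (hy : y ∈ posCone s k) : x + y ∈ posCone s k := by
  induction k with
  | zero => simp [posCone]
  | succ k ih =>
    have hx' := posCone_anti s k.le_succ hx
    have hy' := posCone_anti s k.le_succ hy
    have hxy := ih hx' hy'
    have hratio : 0 < esymmRatio s k (x + y) :=
      (add_pos (esymmRatio_pos hx k.lt_succ_self) (esymmRatio_pos hy k.lt_succ_self)).trans_le
        (esymmRatio_add_le hx' hy' hxy)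
    exact mem_posCone_succ.2 ⟨hxy, (div_pos_iff_of_pos_right (hxy k le_rfl)).1 hratio⟩

lemma esymm_mul_prod_one_add_le (hx : x ∈ posCone s k) (hy : y ∈ posCone s k) :
    esymm s k x * ∏ j ∈ range k, (1 + esymmRatio s j y / esymmRatio s j x) ≤
      esymm s k (x + y) := by
  have hxy := add_mem_posCone hx hy
  rw [← prod_esymmRatio hx, ← prod_esymmRatio hxy, ← prod_mul_distrib]
  refine prod_le_prod (fun j hj => ?_) fun j hj => ?_ <;> rw [mem_range] at hj <;>
    have hxj := esymmRatio_pos hx hj <;> have hyj := esymmRatio_pos hy hj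
  · positivity
  · rw [mul_add, mul_one, mul_div_cancel₀ _ hxj.ne']
    exact esymmRatio_add_le (posCone_anti s hj.le hx) (posCone_anti s hj.le hy)
      (posCone_anti s hj.le hxy)

lemma one_add_sum_le_prod_one_add {κ : Type*} (s : Finset κ) {f : κ → ℝ}
    (hf : ∀ i ∈ s, 0 ≤ f i) : 1 + ∑ i ∈ s, f i ≤ ∏ i ∈ s, (1 + f i) := by
  classical
  induction s using Finset.induction_on with
  | empty => simp
  | insert a s ha ih =>
    rw [forall_mem_insert] at hf
    rw [sum_insert ha, prod_insert ha]
    nlinarith [mul_nonneg hf.1 (sum_nonneg hf.2), mul_le_mul_of_nonneg_left (ih hf.2) hf.1,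
      ih hf.2]

lemma esymm_mul_sum_esymmRatio_le [DecidableEq ι] (hx : x ∈ posCone s (k + 1))
    (hy : y ∈ posCone s (k + 1)) :
    esymm s (k + 1) x * ∑ j ∈ range (k + 1), esymmRatio s j y / esymmRatio s j x ≤
      esymmDeriv s k x y := by
  have hderiv := (hasDerivAt_esymm s k x y 0).tendsto_slope_zero_right
  simp only [zero_add, zero_smul, add_zero, smul_eq_mul] at hderiv
  refine ge_of_tendsto hderiv ?_
  filter_upwards [self_mem_nhdsWithin] with t ht
  rw [Set.mem_Ioi] at ht
  have hty := smul_mem_posCone hy ht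
  have hratio : ∀ j ∈ range (k + 1), 0 ≤ esymmRatio s j (t • y) / esymmRatio s j x :=
    fun j hj => (div_pos (esymmRatio_pos hty (mem_range.1 hj))
      (esymmRatio_pos hx (mem_range.1 hj))).le
  have hBernoulli := mul_le_mul_of_nonneg_left (one_add_sum_le_prod_one_add _ hratio)
    (hx (k + 1) le_rfl).le
  have hprod := hBernoulli.trans (esymm_mul_prod_one_add_le hx hty)
  simp only [esymmRatio_smul s _ ht.ne', mul_div_assoc, ← mul_sum] at hprod
  rw [inv_mul_eq_div, le_div_iff₀ ht]
  linarith

/-- The function `σ_k ^ (1 / k)`, homogeneous of degree one and concave on the Gårding cone. -/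
noncomputable def esymmRoot (s : Finset ι) (k : ℕ) (x : ι → ℝ) : ℝ := esymm s k x ^ (k : ℝ)⁻¹

lemma esymmRoot_pow (hk : k ≠ 0) (hx : 0 ≤ esymm s k x) : esymmRoot s k x ^ k = esymm s k x :=
  Real.rpow_inv_natCast_pow hx hk

lemma esymmRoot_pos (hx : x ∈ posCone s k) : 0 < esymmRoot s k x :=
  Real.rpow_pos_of_pos (hx k le_rfl) _

lemma continuous_esymmRoot (s : Finset ι) (k : ℕ) : Continuous (esymmRoot s k) :=
  (continuous_esymm s k).rpow_const fun _ => Or.inr (by positivity)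

lemma garding_of_mem_posCone [DecidableEq ι] (hx : x ∈ posCone s (k + 1))
    (hy : y ∈ posCone s (k + 1)) :
    (k + 1) * (esymmRoot s (k + 1) y * esymmRoot s (k + 1) x ^ k) ≤ esymmDeriv s k x y := by
  refine le_trans ?_ (esymm_mul_sum_esymmRatio_le hx hy)
  have hratio : ∀ j ∈ range (k + 1), 0 ≤ esymmRatio s j y / esymmRatio s j x := fun j hj =>
    (div_pos (esymmRatio_pos hy (mem_range.1 hj)) (esymmRatio_pos hx (mem_range.1 hj))).le
  have hAMGM := Real.geom_mean_le_arith_mean (range (k + 1)) (fun _ => 1) _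
    (fun _ _ => zero_le_one) (by simpa using k.cast_add_one_pos) hratio
  simp only [Real.rpow_one, one_mul, sum_const, card_range, nsmul_eq_mul, mul_one,
    prod_div_distrib, prod_esymmRatio hx, prod_esymmRatio hy] at hAMGM
  rw [Real.div_rpow (hy _ le_rfl).le (hx _ le_rfl).le, ← esymmRoot, ← esymmRoot,
    le_div_iff₀ (by positivity)] at hAMGM
  have hroot := esymmRoot_pos hx
  calc (k + 1) * (esymmRoot s (k + 1) y * esymmRoot s (k + 1) x ^ k)
      = esymmRoot s (k + 1) x ^ (k + 1) *
          (esymmRoot s (k + 1) y / esymmRoot s (k + 1) x * (k + 1 : ℕ)) := by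
        push_cast
        field_simp
        ring
    _ ≤ _ := by
        rw [esymmRoot_pow k.succ_ne_zero (hx _ le_rfl).le]
        exact mul_le_mul_of_nonneg_left hAMGM (hx _ le_rfl).le

lemma add_smul_one_mem_posCone (hk : k ≤ #s) (hx : x ∈ nonnegCone s k) {ε : ℝ} (hε : 0 < ε) :
    x + ε • 1 ∈ posCone s k := by
  classical
  induction k generalizing ε with
  | zero => simp [posCone]
  | succ k ih =>
    have hmem : ∀ t : ℝ, 0 < t → x + t • 1 ∈ posCone s k := fun t ht =>
      ih (by omega) (nonnegCone_anti s k.le_succ hx) ht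
    have hmono : StrictMonoOn (fun t : ℝ => esymm s (k + 1) (x + t • 1)) (Set.Ici 0) := by
      refine strictMonoOn_of_deriv_pos (convex_Ici 0)
        (fun t _ => (hasDerivAt_esymm s k x 1 t).continuousAt.continuousWithinAt) fun t ht => ?_
      rw [interior_Ici] at ht
      rw [(hasDerivAt_esymm s k x 1 t).deriv, esymmDeriv_one]
      exact mul_pos (sub_pos.2 (by exact_mod_cast hk)) (hmem t ht k le_rfl)
    have hlt := hmono Set.self_mem_Ici (Set.mem_Ici.2 hε.le) hε
    simp only [zero_smul, add_zero] at hlt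
    exact mem_posCone_succ.2 ⟨hmem ε hε, (hx _ le_rfl).trans_lt hlt⟩

lemma tendsto_add_smul_one (x : ι → ℝ) : Tendsto (fun ε : ℝ => x + ε • 1) (𝓝[>] 0) (𝓝 x) := by
  have hcont : Continuous fun ε : ℝ => x + ε • (1 : ι → ℝ) := by fun_prop
  simpa using (hcont.tendsto 0).mono_left nhdsWithin_le_nhds

lemma eventually_add_smul_one_mem_posCone (hk : k ≤ #s) (hx : x ∈ nonnegCone s k) :
    ∀ᶠ ε : ℝ in 𝓝[>] 0, x + ε • 1 ∈ posCone s k :=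
  eventually_mem_nhdsWithin.mono fun _ => add_smul_one_mem_posCone hk hx

lemma closure_posCone (hk : k ≤ #s) : closure (posCone s k) = nonnegCone s k :=
  (closure_minimal (posCone_subset_nonnegCone s k) (isClosed_nonnegCone s k)).antisymm
    fun x hx => mem_closure_of_tendsto (tendsto_add_smul_one x)
      (eventually_add_smul_one_mem_posCone hk hx)

lemma mem_nonnegCone_erase [DecidableEq ι] (hk : k + 1 ≤ #s) (hx : x ∈ nonnegCone s (k + 1)) {i : ι}
    (hi : i ∈ s) : x ∈ nonnegCone (s.erase i) k :=
  (isClosed_nonnegCone _ _).mem_of_tendsto (tendsto_add_smul_one x) <|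
    (eventually_add_smul_one_mem_posCone hk hx).mono fun _ hε =>
      posCone_subset_nonnegCone _ _ (mem_posCone_erase hε hi)

/-- **Gårding's inequality**: the tangent hyperplanes of the concave function
`σ_{k+1} ^ (1 / (k + 1))` lie above its graph. -/
lemma garding [DecidableEq ι] (hk : k + 1 ≤ #s) (hx : x ∈ posCone s (k + 1))
    (hy : y ∈ nonnegCone s (k + 1)) :
    (k + 1) * (esymmRoot s (k + 1) y * esymmRoot s (k + 1) x ^ k) ≤ esymmDeriv s k x y := by
  have hclosed : IsClosed {y | (k + 1) * (esymmRoot s (k + 1) y * esymmRoot s (k + 1) x ^ k) ≤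
      esymmDeriv s k x y} := by
    refine isClosed_le ?_ (by unfold esymmDeriv; fun_prop)
    exact continuous_const.mul ((continuous_esymmRoot s _).mul continuous_const)
  rw [← closure_posCone hk] at hy
  exact closure_minimal (fun y hy => garding_of_mem_posCone hx hy) hclosed hy

lemma esymmDeriv_mono_right [DecidableEq ι] {z : ι → ℝ} (hx : x ∈ posCone s (k + 1))
    (hyz : ∀ i ∈ s, y i ≤ z i) :
    esymmDeriv s k x y ≤ esymmDeriv s k x z :=
  sum_le_sum fun i hi =>
    mul_le_mul_of_nonneg_right (hyz i hi) (mem_posCone_erase hx hi k le_rfl).le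

lemma esymm_succ_eq_zero (hk : k + 1 ≤ #s) (hx : x ∈ nonnegCone s (k + 1))
    (hzero : esymm s k x = 0) : esymm s (k + 1) x = 0 := by
  classical
  have herase : ∀ i ∈ s, esymm (s.erase i) k x = 0 := by
    have hsum := esymmDeriv_one s k x
    simp only [esymmDeriv, Pi.one_apply, one_mul, hzero, mul_zero] at hsum
    exact (sum_eq_zero_iff_of_nonneg fun i hi => mem_nonnegCone_erase hk hx hi k le_rfl).1 hsum
  have hEuler : (k + 1) * esymm s (k + 1) x = 0 := by
    rw [← esymmDeriv_self, esymmDeriv, sum_eq_zero fun i hi => by rw [herase i hi, mul_zero]]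
  exact (mul_eq_zero.1 hEuler).resolve_left k.cast_add_one_ne_zero

lemma mem_posCone_of_esymm_pos (hk : k ≤ #s) (hx : x ∈ nonnegCone s k) (hpos : 0 < esymm s k x) :
    x ∈ posCone s k := by
  classical
  induction k with
  | zero => simp [posCone]
  | succ k ih =>
    have hx' := nonnegCone_anti s k.le_succ hx
    have hpos' : 0 < esymm s k x :=
      (hx' k le_rfl).lt_of_ne' fun hzero => hpos.ne' (esymm_succ_eq_zero hk hx hzero)
    exact mem_posCone_succ.2 ⟨ih (by omega) hx' hpos', hpos⟩

end Cones

section Unbounded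

variable {s : Finset ι} {k : ℕ} {x y w : ι → ℝ}

lemma esymm_one_mul_pow_le {m : ℕ} (hx : x ∈ posCone s (m + 2)) :
    esymm s 1 x * esymm s (m + 2) x ^ m ≤ esymm s (m + 1) x ^ (m + 1) := by
  induction m with
  | zero => simp
  | succ m ih =>
    have hm₁ := hx (m + 1) (by omega)
    have hm₂ := hx (m + 2) (by omega)
    have hm₃ := hx (m + 3) le_rfl
    have hone := hx 1 (by omega)
    have hNewton := esymm_mul_esymm_le_sq s (m + 1) x
    refine le_of_mul_le_mul_left ?_ (pow_pos hm₁ (m + 1))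
    calc esymm s (m + 1) x ^ (m + 1) * (esymm s 1 x * esymm s (m + 3) x ^ (m + 1))
        = esymm s 1 x * (esymm s (m + 1) x * esymm s (m + 3) x) ^ (m + 1) := by ring
      _ ≤ esymm s 1 x * (esymm s (m + 2) x ^ 2) ^ (m + 1) := by gcongr
      _ = esymm s 1 x * esymm s (m + 2) x ^ m * esymm s (m + 2) x ^ (m + 2) := by ring
      _ ≤ esymm s (m + 1) x ^ (m + 1) * esymm s (m + 2) x ^ (m + 2) := by
        gcongr
        exact ih (posCone_anti s (by omega) hx)

/-- The positive multiple of `x ∈ posCone s k` on which `σ_k` takes the value `1`. -/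
noncomputable def normalize (s : Finset ι) (k : ℕ) (x : ι → ℝ) : ι → ℝ := (esymmRoot s k x)⁻¹ • x

lemma normalize_mem_posCone (hx : x ∈ posCone s k) : normalize s k x ∈ posCone s k :=
  smul_mem_posCone hx (inv_pos.2 (esymmRoot_pos hx))

lemma esymm_normalize (hk : k ≠ 0) (hx : x ∈ posCone s k) : esymm s k (normalize s k x) = 1 := by
  rw [normalize, esymm_smul, inv_pow, esymmRoot_pow hk (hx k le_rfl).le,
    inv_mul_cancel₀ (hx k le_rfl).ne']

lemma esymmDeriv_normalize_le [DecidableEq ι] (hx : x ∈ posCone s (k + 1))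
    (hyx : ∀ i ∈ s, y i ≤ x i) :
    esymmDeriv s k (normalize s (k + 1) x) y ≤ (k + 1) * esymmRoot s (k + 1) x := by
  have hroot := esymmRoot_pos hx
  calc esymmDeriv s k (normalize s (k + 1) x) y
      ≤ esymmDeriv s k (normalize s (k + 1) x) x :=
        esymmDeriv_mono_right (normalize_mem_posCone hx) hyx
    _ = (k + 1) * esymmRoot s (k + 1) x := by
        rw [normalize, esymmDeriv_smul_left, esymmDeriv_self,
          ← esymmRoot_pow k.succ_ne_zero (hx _ le_rfl).le, pow_succ, inv_pow]
        field_simp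

lemma exists_esymmDeriv_lt_of_mem [DecidableEq ι] (hk : k + 1 ≤ #s)
    (hy : y ∈ nonnegCone s (k + 1)) {c : ℝ} (hc : (k + 1) * esymmRoot s (k + 1) y < c) :
    ∃ x ∈ posCone s (k + 1), esymm s (k + 1) x = 1 ∧ esymmDeriv s k x y < c := by
  have htendsto : Tendsto (fun ε : ℝ => (k + 1) * esymmRoot s (k + 1) (y + ε • 1)) (𝓝[>] 0)
      (𝓝 ((k + 1) * esymmRoot s (k + 1) y)) :=
    (((continuous_esymmRoot s _).tendsto y).comp (tendsto_add_smul_one y)).const_mul _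
  obtain ⟨ε, hlt, hmem, hε⟩ := ((htendsto.eventually_lt_const hc).and
    ((eventually_add_smul_one_mem_posCone hk hy).and self_mem_nhdsWithin)).exists
  refine ⟨normalize s (k + 1) (y + ε • 1), normalize_mem_posCone hmem,
    esymm_normalize k.succ_ne_zero hmem, (esymmDeriv_normalize_le hmem fun i _ => ?_).trans_lt hlt⟩
  simpa using (Set.mem_Ioi.1 hε).le

lemma exists_add_smul_one_mem_boundary (hk : k ≤ #s) (hy : y ∉ nonnegCone s k) :
    ∃ τ : ℝ, 0 < τ ∧ y + τ • 1 ∈ nonnegCone s k ∧ esymm s k (y + τ • 1) = 0 := by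
  have hcont : Continuous fun t : ℝ => y + t • (1 : ι → ℝ) := by fun_prop
  set T : Set ℝ := {t | 0 ≤ t ∧ y + t • 1 ∈ nonnegCone s k}
  have hclosed : IsClosed T := isClosed_Ici.inter ((isClosed_nonnegCone s k).preimage hcont)
  have hnonempty : T.Nonempty := by
    refine ⟨∑ i ∈ s, |y i|, sum_nonneg fun _ _ => abs_nonneg _, fun j _ =>
      esymm_nonneg (fun i hi => ?_) j⟩
    have hle := single_le_sum (f := fun i => |y i|) (fun _ _ => abs_nonneg _) hi
    simp only [Pi.add_apply, Pi.smul_apply, Pi.one_apply, smul_eq_mul, mul_one]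
    linarith [neg_abs_le (y i)]
  have hbdd : BddBelow T := ⟨0, fun t ht => ht.1⟩
  obtain ⟨hτ, hmem⟩ := hclosed.csInf_mem hnonempty hbdd
  set τ := sInf T
  have hτ₀ : 0 < τ := hτ.lt_of_ne fun h => hy (by simpa [← h] using hmem)
  refine ⟨τ, hτ₀, hmem, ((hmem k le_rfl).eq_of_not_lt fun hpos => ?_).symm⟩
  have hopen : ∀ᶠ t in 𝓝[<] τ, y + t • 1 ∈ posCone s k :=
    nhdsWithin_le_nhds <| ((isOpen_posCone s k).preimage hcont).mem_nhds
      (mem_posCone_of_esymm_pos hk hmem hpos)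
  obtain ⟨t, htmem, htτ, ht₀⟩ := (hopen.and (eventually_mem_nhdsWithin.and
    (nhdsWithin_le_nhds (Ioi_mem_nhds hτ₀)))).exists
  exact (csInf_le hbdd ⟨le_of_lt ht₀, posCone_subset_nonnegCone s k htmem⟩).not_gt htτ

-- Here `y + τ • 1` vanishes on `s` and hence has `σ₁ = 0`, so a coordinate vector takes its place.
lemma exists_boundary_of_eqOn_neg (hk : 2 ≤ k) (hs : s.Nonempty) {τ : ℝ}
    (hy : ∀ i ∈ s, y i = -τ) :
    ∃ w ∈ nonnegCone s k, esymm s k w = 0 ∧ 0 < esymm s 1 w ∧ ∀ i ∈ s, y i + τ ≤ w i := by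
  classical
  obtain ⟨a, ha⟩ := hs
  have hnonneg : ∀ i, 0 ≤ (Pi.single a 1 : ι → ℝ) i := fun i =>
    (Pi.single_nonneg (α := fun _ => ℝ)).2 zero_le_one i
  obtain ⟨m, rfl⟩ := Nat.exists_eq_add_of_le' hk
  have herase (j : ℕ) : esymm (s.erase a) (j + 1) (Pi.single a 1 : ι → ℝ) = 0 := by
    rw [esymm_congr (y := (0 : ℝ) • 0) fun i hi => by simp [ne_of_mem_erase hi], esymm_smul]
    simp
  refine ⟨Pi.single a 1, fun j _ => esymm_nonneg (fun i _ => hnonneg i) j, ?_, ?_,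
    fun i hi => by simpa [hy i hi] using hnonneg i⟩
  · rw [esymm_succ_eq_add_erase ha, herase, herase, mul_zero, add_zero]
  · rw [esymm_succ_eq_add_erase ha, herase, esymm_zero]
    simp

lemma exists_boundary_of_notMem (hk : 2 ≤ k) (hks : k ≤ #s) (hy : y ∉ nonnegCone s k) :
    ∃ τ : ℝ, 0 < τ ∧ ∃ w ∈ nonnegCone s k,
      esymm s k w = 0 ∧ 0 < esymm s 1 w ∧ ∀ i ∈ s, y i + τ ≤ w i := by
  obtain ⟨τ, hτ, hmem, hzero⟩ := exists_add_smul_one_mem_boundary hks hy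
  refine ⟨τ, hτ, ?_⟩
  rcases (hmem 1 (by omega)).lt_or_eq with hone | hone
  · exact ⟨y + τ • 1, hmem, hzero, hone, fun i _ => by simp⟩
  · refine exists_boundary_of_eqOn_neg hk (card_pos.1 (by omega)) fun i hi => ?_
    have hsq : ∑ i ∈ s, (y + τ • 1) i ^ 2 ≤ 0 := by
      rw [sum_sq_eq_esymm, ← hone]
      linarith [hmem 2 hk]
    have hsq_i := (single_le_sum (fun i _ => sq_nonneg ((y + τ • 1) i)) hi).trans hsq
    have hentry : (y + τ • 1) i = 0 := by nlinarith
    simpa [eq_neg_iff_add_eq_zero] using hentry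

lemma exists_lt_esymm_of_boundary [DecidableEq ι] (hk : 1 ≤ k) (hks : k + 1 ≤ #s)
    (hw : w ∈ nonnegCone s (k + 1)) (hzero : esymm s (k + 1) w = 0) (hone : 0 < esymm s 1 w)
    (b : ℝ) :
    ∃ x ∈ posCone s (k + 1), esymm s (k + 1) x = 1 ∧ esymmDeriv s k x w ≤ k + 1 ∧
      b < esymm s k x := by
  obtain ⟨m, rfl⟩ := Nat.exists_eq_add_of_le' hk
  have hroot : Tendsto (fun ε : ℝ => esymmRoot s (m + 2) (w + ε • 1)) (𝓝[>] 0)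
      (𝓝 (esymmRoot s (m + 2) w)) :=
    ((continuous_esymmRoot s _).tendsto w).comp (tendsto_add_smul_one w)
  rw [esymmRoot, hzero, Real.zero_rpow (by positivity)] at hroot
  have hσ_one : Tendsto (fun ε : ℝ => esymm s 1 (w + ε • 1)) (𝓝[>] 0) (𝓝 (esymm s 1 w)) :=
    ((continuous_esymm s 1).tendsto w).comp (tendsto_add_smul_one w)
  have hscaled : ∀ᶠ ε : ℝ in 𝓝[>] 0,
      esymmRoot s (m + 2) (w + ε • 1) * |b| ^ (m + 1) < esymm s 1 (w + ε • 1) :=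
    (hroot.mul_const _).eventually_lt hσ_one (by rwa [zero_mul])
  obtain ⟨ε, ⟨hlt_one, hlt⟩, hmem, hε⟩ :=
    (((hroot.eventually_lt_const one_pos).and hscaled).and
      ((eventually_add_smul_one_mem_posCone hks hw).and self_mem_nhdsWithin)).exists
  have hx := normalize_mem_posCone hmem
  have hx_one := esymm_normalize (by omega) hmem
  refine ⟨_, hx, hx_one, (esymmDeriv_normalize_le hmem fun i _ => ?_).trans ?_, ?_⟩
  · simpa using (Set.mem_Ioi.1 hε).le
  · exact mul_le_of_le_one_right (by positivity) hlt_one.le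
  · have hNewton := esymm_one_mul_pow_le hx
    rw [hx_one, one_pow, mul_one] at hNewton
    have hpow : |b| ^ (m + 1) < esymm s 1 (normalize s (m + 2) (w + ε • 1)) := by
      rwa [normalize, esymm_smul, pow_one, lt_inv_mul_iff₀ (esymmRoot_pos hmem)]
    exact (le_abs_self b).trans_lt
      (lt_of_pow_lt_pow_left₀ _ (hx _ (Nat.le_succ _)).le (hpow.trans_le hNewton))

lemma exists_esymmDeriv_lt_of_notMem [DecidableEq ι] (hk : 1 ≤ k) (hks : k + 1 ≤ #s)
    (hy : y ∉ nonnegCone s (k + 1)) (c : ℝ) :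
    ∃ x ∈ posCone s (k + 1), esymm s (k + 1) x = 1 ∧ esymmDeriv s k x y < c := by
  obtain ⟨τ, hτ, w, hw, hzero, hone, hyw⟩ := exists_boundary_of_notMem (by omega) hks hy
  obtain ⟨x, hx, hx_one, hxw, hlt⟩ :=
    exists_lt_esymm_of_boundary hk hks hw hzero hone ((k + 1 - c) / τ)
  refine ⟨x, hx, hx_one, ?_⟩
  have hcard : (1 : ℝ) ≤ #s - k := le_sub_iff_add_le'.2 (by exact_mod_cast hks)
  have hσ := hx k k.le_succ
  calc esymmDeriv s k x y ≤ esymmDeriv s k x (w - τ • 1) :=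
        esymmDeriv_mono_right hx fun i hi => by simpa [le_sub_iff_add_le] using hyw i hi
    _ = esymmDeriv s k x w - τ * ((#s - k) * esymm s k x) := by
        rw [esymmDeriv_sub_right, esymmDeriv_smul_right, esymmDeriv_one]
    _ ≤ (k + 1) - τ * (1 * esymm s k x) := by gcongr
    _ < c := by
        rw [div_lt_iff₀ hτ] at hlt
        linarith

end Unbounded

section Spectral

variable {n : Type*} [Fintype n]

lemma exists_perm_of_map_univ_eq {ι α : Type*} [Fintype ι] {f g : ι → α}
    (h : (univ : Finset ι).val.map f = (univ : Finset ι).val.map g) :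
    ∃ π : Equiv.Perm ι, g ∘ π = f := by
  classical
  have hfiber (a : α) : Nonempty ({i // f i = a} ≃ {i // g i = a}) := by
    have hcount := congrArg (Multiset.count a) h
    rw [Multiset.count_map, Multiset.count_map] at hcount
    refine ⟨Fintype.equivOfCardEq ?_⟩
    rw [Fintype.card_subtype, Fintype.card_subtype]
    simp only [eq_comm (a := a)] at hcount
    exact hcount
  exact ⟨Equiv.ofFiberEquiv fun a => (hfiber a).some, funext fun i => Equiv.ofFiberEquiv_map _ i⟩

lemma trace_transpose_mul_mul_of_isHermitian {A : Matrix n n ℝ} (hA : A.IsHermitian)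
    (M : Matrix n n ℝ) : (A.transpose * M * A).trace = (M * (A * A)).trace := by
  rw [← Matrix.conjTranspose_eq_transpose_of_trivial, hA.eq, Matrix.mul_assoc,
    Matrix.trace_mul_comm, Matrix.mul_assoc]

variable [DecidableEq n]

lemma le_sum_of_mem_doublyStochastic {a b : n → ℝ} {c : ℝ}
    (h : ∀ π : Equiv.Perm n, c ≤ ∑ i, a i * b (π i)) {P : Matrix n n ℝ}
    (hP : P ∈ doublyStochastic ℝ n) : c ≤ ∑ i, ∑ j, P i j * (a i * b j) := by
  have hlin : IsLinearMap ℝ fun P : Matrix n n ℝ => ∑ i, ∑ j, P i j * (a i * b j) :=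
    ⟨fun P Q => by simp [add_mul, sum_add_distrib], fun r P => by simp [mul_sum, mul_assoc]⟩
  rw [← SetLike.mem_coe, doublyStochastic_eq_convexHull_permMatrix] at hP
  refine convexHull_min ?_ (convex_halfSpace_ge hlin c) hP
  rintro _ ⟨π, rfl⟩
  simpa [PEquiv.toMatrix_apply] using h π

lemma sq_entries_mem_doublyStochastic {W : Matrix n n ℝ} (hW : W ∈ Matrix.unitaryGroup n ℝ) :
    Matrix.of (fun i j => W i j ^ 2) ∈ doublyStochastic ℝ n := by
  refine mem_doublyStochastic_iff_sum.2 ⟨fun i j => sq_nonneg _, fun i => ?_, fun j => ?_⟩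
  · simpa [Matrix.mul_apply, sq] using congrFun₂ (Matrix.mem_unitaryGroup_iff.1 hW) i i
  · simpa [Matrix.mul_apply, sq] using congrFun₂ (Matrix.mem_unitaryGroup_iff'.1 hW) j j

open Unitary (conjStarAlgAut)

lemma trace_diagonal_mul_conj_diagonal (a b : n → ℝ) (W : Matrix n n ℝ) :
    (Matrix.diagonal a * (W * Matrix.diagonal b * star W)).trace =
      ∑ i, ∑ j, W i j ^ 2 * (a i * b j) := by
  simp only [Matrix.trace, Matrix.diag_apply, Matrix.diagonal_mul, Matrix.mul_apply (N := star W),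
    Matrix.mul_diagonal, Matrix.star_apply, star_trivial, mul_sum]
  exact sum_congr rfl fun i _ => sum_congr rfl fun j _ => by ring

lemma trace_conj_diagonal_mul_conj_diagonal (V U : Matrix.unitaryGroup n ℝ) (a b : n → ℝ) :
    (conjStarAlgAut ℝ _ V (Matrix.diagonal a) * conjStarAlgAut ℝ _ U (Matrix.diagonal b)).trace =
      ∑ i, ∑ j, (star (V : Matrix n n ℝ) * (U : Matrix n n ℝ)) i j ^ 2 * (a i * b j) := by
  rw [← trace_diagonal_mul_conj_diagonal, Unitary.conjStarAlgAut_apply,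
    Unitary.conjStarAlgAut_apply, Matrix.mul_assoc (V : Matrix n n ℝ), Matrix.mul_assoc,
    Matrix.trace_mul_comm]
  simp only [Matrix.mul_assoc, star_mul, star_star]

lemma eq_conj_diagonal_eigenvalues {M : Matrix n n ℝ} (hM : M.IsHermitian) :
    M = conjStarAlgAut ℝ _ hM.eigenvectorUnitary (Matrix.diagonal hM.eigenvalues) :=
  hM.spectral_theorem

lemma conj_diagonal_mul_self (U : Matrix.unitaryGroup n ℝ) (b : n → ℝ) :
    conjStarAlgAut ℝ _ U (Matrix.diagonal b) * conjStarAlgAut ℝ _ U (Matrix.diagonal b) =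
      conjStarAlgAut ℝ _ U (Matrix.diagonal (b ^ 2)) := by
  rw [← map_mul, Matrix.diagonal_mul_diagonal, sq]
  rfl

lemma exists_doublyStochastic_trace {M A : Matrix n n ℝ} (hM : M.IsHermitian)
    (hA : A.IsHermitian) : ∃ P ∈ doublyStochastic ℝ n,
      (A.transpose * M * A).trace =
        ∑ i, ∑ j, P i j * (hM.eigenvalues i * hA.eigenvalues j ^ 2) := by
  refine ⟨_, sq_entries_mem_doublyStochastic
    (star hM.eigenvectorUnitary * hA.eigenvectorUnitary).2, ?_⟩
  have hA_sq : A * A =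
      conjStarAlgAut ℝ _ hA.eigenvectorUnitary (Matrix.diagonal (hA.eigenvalues ^ 2)) := by
    rw [← conj_diagonal_mul_self, ← eq_conj_diagonal_eigenvalues hA]
  rw [trace_transpose_mul_mul_of_isHermitian hA, hA_sq]
  conv_lhs => rw [eq_conj_diagonal_eigenvalues hM]
  exact trace_conj_diagonal_mul_conj_diagonal _ _ _ _

lemma exists_perm_eigenvalues_conj_diagonal (V : Matrix.unitaryGroup n ℝ) (b : n → ℝ)
    (h : (conjStarAlgAut ℝ _ V (Matrix.diagonal b)).IsHermitian) :
    ∃ π : Equiv.Perm n, b ∘ π = h.eigenvalues := by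
  refine exists_perm_of_map_univ_eq ?_
  have hcharpoly : (conjStarAlgAut ℝ _ V (Matrix.diagonal b)).charpoly =
      ∏ i, (Polynomial.X - Polynomial.C (b i)) := by
    rw [Unitary.conjStarAlgAut_apply, Matrix.charpoly_mul_comm, ← Matrix.mul_assoc,
      Unitary.coe_star_mul_self, Matrix.one_mul, Matrix.charpoly_diagonal]
  have hroots := h.roots_charpoly_eq_eigenvalues
  have hprod : ∏ i, (Polynomial.X - Polynomial.C (b i)) =
      ((univ.val.map b).map fun r => Polynomial.X - Polynomial.C r).prod := by
    rw [Multiset.map_map]; rfl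
  rw [hcharpoly, hprod, Polynomial.roots_multiset_prod_X_sub_C] at hroots
  exact hroots.symm

lemma exists_posSemidef_trace {M : Matrix n n ℝ} (hM : M.IsHermitian) {b : n → ℝ}
    (hb : 0 ≤ b) : ∃ (A : Matrix n n ℝ) (hA : A.PosSemidef) (π : Equiv.Perm n),
      b ∘ π = hA.isHermitian.eigenvalues ∧
        (A.transpose * M * A).trace = ∑ i, hM.eigenvalues i * b i ^ 2 := by
  set V := hM.eigenvectorUnitary
  have hA : (conjStarAlgAut ℝ _ V (Matrix.diagonal b)).PosSemidef := by
    rw [Unitary.conjStarAlgAut_apply]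
    exact (Matrix.posSemidef_diagonal_iff.2 hb).mul_mul_conjTranspose_same _
  obtain ⟨π, hπ⟩ := exists_perm_eigenvalues_conj_diagonal V b hA.isHermitian
  refine ⟨_, hA, π, hπ, ?_⟩
  rw [trace_transpose_mul_mul_of_isHermitian hA.isHermitian, conj_diagonal_mul_self]
  conv_lhs => rw [eq_conj_diagonal_eigenvalues hM]
  rw [trace_conj_diagonal_mul_conj_diagonal, Unitary.coe_star_mul_self]
  simp [Matrix.one_apply]

end Spectral

section Operator

section Permutation

variable [Fintype ι]

lemma esymm_univ_comp_perm (π : Equiv.Perm ι) (k : ℕ) (x : ι → ℝ) :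
    esymm univ k (x ∘ π) = esymm univ k x := by
  simpa using (esymm_map π.toEmbedding univ k x).symm

lemma esymm_erase_comp_perm [DecidableEq ι] (π : Equiv.Perm ι) (i : ι) (k : ℕ) (x : ι → ℝ) :
    esymm (univ.erase i) k (x ∘ π) = esymm (univ.erase (π i)) k x := by
  simpa [map_erase] using (esymm_map π.toEmbedding (univ.erase i) k x).symm

lemma comp_perm_mem_posCone {k : ℕ} {x : ι → ℝ} (hx : x ∈ posCone univ k) (π : Equiv.Perm ι) :
    x ∘ π ∈ posCone univ k := fun j hj => by
  rw [esymm_univ_comp_perm]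
  exact hx j hj

end Permutation

variable {n k : ℕ}

lemma sigma_eq_esymm (k : ℕ) (γ : Fin n → ℝ) : sigma k γ = esymm univ k γ := by
  simp [sigma, MvPolynomial.esymm, esymm_eq_sum]

lemma sigmaOmit_eq_esymm_erase (k : ℕ) (i : Fin n) (γ : Fin n → ℝ) :
    sigmaOmit k i γ = esymm (univ.erase i) k γ := by
  have hcongr : esymm (univ.erase i) k (Function.update γ i 0) = esymm (univ.erase i) k γ :=
    esymm_congr (fun j hj => Function.update_of_ne (ne_of_mem_erase hj) _ _) k
  rw [sigmaOmit, sigma_eq_esymm, ← hcongr]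
  cases k with
  | zero => simp
  | succ k => simp [esymm_succ_eq_add_erase (mem_univ i)]

lemma forall_le_iff_forall_one_le_of_zero {p : ℕ → Prop} (h : p 0) :
    (∀ j ≤ k, p j) ↔ ∀ j, 1 ≤ j → j ≤ k → p j :=
  ⟨fun hp j _ => hp j, fun hp j hj => j.eq_zero_or_pos.elim (· ▸ h) fun hj₀ => hp j hj₀ hj⟩

lemma gardingCone_eq_posCone (n k : ℕ) : gardingCone n k = posCone univ k := by
  ext γ
  simp only [gardingCone, posCone, Set.mem_ofPred_eq, sigma_eq_esymm]
  exact (forall_le_iff_forall_one_le_of_zero (by simp)).symm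

lemma closure_gardingCone (hkn : k ≤ n) : closure (gardingCone n k) = nonnegCone univ k := by
  rw [gardingCone_eq_posCone, closure_posCone (by simpa using hkn)]

lemma mem_closure_gardingCone_iff (hkn : k ≤ n) {γ : Fin n → ℝ} :
    γ ∈ closure (gardingCone n k) ↔ ∀ j : ℕ, 1 ≤ j → j ≤ k → 0 ≤ sigma j γ := by
  simp only [closure_gardingCone hkn, nonnegCone, Set.mem_ofPred_eq, sigma_eq_esymm]
  exact forall_le_iff_forall_one_le_of_zero (by simp)

variable {M : Matrix (Fin n) (Fin n) ℝ}

lemma infOp_coeffSet_lt (hM : M.IsHermitian) {γ : Fin n → ℝ} (hγ : γ ∈ posCone univ (k + 1))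
    (hone : esymm univ (k + 1) γ = 1) {c : ℝ} (hc : esymmDeriv univ k γ hM.eigenvalues < c) :
    infOp (coeffSet n (k + 1)) M < c := by
  have hnonneg (i : Fin n) : 0 ≤ esymm (univ.erase i) k γ :=
    (mem_posCone_erase hγ (mem_univ i) k le_rfl).le
  obtain ⟨A, hA, π, hπ, htrace⟩ := exists_posSemidef_trace hM
    (b := fun i => √(esymm (univ.erase i) k γ)) fun i => Real.sqrt_nonneg _
  have hmem : A ∈ coeffSet n (k + 1) := by
    refine ⟨hA, γ ∘ π, ?_, ?_, fun i => ?_⟩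
    · rw [gardingCone_eq_posCone]
      exact comp_perm_mem_posCone hγ π
    · rw [sigma_eq_esymm, esymm_univ_comp_perm, hone]
    · rw [← hπ, Function.comp_apply, Real.sq_sqrt (hnonneg _), sigmaOmit_eq_esymm_erase,
        Nat.add_sub_cancel, esymm_erase_comp_perm]
  simp only [Real.sq_sqrt (hnonneg _)] at htrace
  refine (iInf₂_le A hmem).trans_lt ?_
  rw [htrace]
  exact_mod_cast hc

lemma le_infOp_coeffSet (hkn : k + 1 ≤ n) (hM : M.IsHermitian)
    (hmem : hM.eigenvalues ∈ nonnegCone univ (k + 1)) :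
    (((k + 1) * esymmRoot univ (k + 1) hM.eigenvalues : ℝ) : EReal) ≤
      infOp (coeffSet n (k + 1)) M := by
  refine le_iInf₂ fun A ⟨hA, γ, hγ, hone, heig⟩ => ?_
  rw [gardingCone_eq_posCone] at hγ
  rw [sigma_eq_esymm] at hone
  simp only [sigmaOmit_eq_esymm_erase, Nat.add_sub_cancel] at heig
  obtain ⟨P, hP, htrace⟩ := exists_doublyStochastic_trace hM hA.isHermitian
  rw [htrace, EReal.coe_le_coe_iff]
  refine le_sum_of_mem_doublyStochastic (fun π => ?_) hP
  have hroot : esymmRoot univ (k + 1) (γ ∘ π) = 1 := by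
    rw [esymmRoot, esymm_univ_comp_perm, hone, Real.one_rpow]
  have hGarding := garding (by simpa using hkn) (comp_perm_mem_posCone hγ π) hmem
  rw [hroot, one_pow, mul_one] at hGarding
  simpa only [heig, esymmDeriv, esymm_erase_comp_perm] using hGarding

lemma infOp_coeffSet_of_mem (hk : 1 ≤ k) (hkn : k ≤ n) (hM : M.IsHermitian)
    (hmem : hM.eigenvalues ∈ closure (gardingCone n k)) :
    infOp (coeffSet n k) M = ((k * sigma k hM.eigenvalues ^ (1 / (k : ℝ)) : ℝ) : EReal) := by
  obtain ⟨m, rfl⟩ := Nat.exists_eq_add_of_le' hk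
  rw [closure_gardingCone hkn] at hmem
  rw [sigma_eq_esymm, one_div, ← esymmRoot, Nat.cast_succ]
  refine le_antisymm (EReal.le_of_forall_lt_iff_le.1 fun c hc => ?_)
    (le_infOp_coeffSet hkn hM hmem)
  obtain ⟨γ, hγ, hone, hlt⟩ :=
    exists_esymmDeriv_lt_of_mem (by simpa using hkn) hmem (EReal.coe_lt_coe_iff.1 hc)
  exact (infOp_coeffSet_lt hM hγ hone hlt).le

lemma infOp_coeffSet_of_notMem (hk : 2 ≤ k) (hkn : k ≤ n) (hM : M.IsHermitian)
    (hmem : hM.eigenvalues ∉ closure (gardingCone n k)) : infOp (coeffSet n k) M = ⊥ := by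
  obtain ⟨m, rfl⟩ := Nat.exists_eq_add_of_le' (one_le_two.trans hk)
  rw [closure_gardingCone hkn] at hmem
  refine (EReal.eq_bot_iff_forall_lt _).2 fun c => ?_
  obtain ⟨γ, hγ, hone, hlt⟩ :=
    exists_esymmDeriv_lt_of_notMem (by omega) (by simpa using hkn) hmem c
  exact infOp_coeffSet_lt hM hγ hone hlt

lemma finiteCone_coeffSet (hk : 2 ≤ k) (hkn : k ≤ n) :
    finiteCone (coeffSet n k) = closedConeMat n k := by
  ext M
  refine ⟨fun ⟨hM, hlt⟩ => ⟨hM, ?_⟩, fun ⟨hM, hmem⟩ => ⟨hM, ?_⟩⟩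
  · by_contra hmem
    exact hlt.ne' (infOp_coeffSet_of_notMem hk hkn hM hmem)
  · rw [infOp_coeffSet_of_mem (one_le_two.trans hk) hkn hM hmem]
    exact EReal.bot_lt_coe _

lemma kConvex_iff_admissible (hk : 2 ≤ k) (hkn : k ≤ n) (Ω : Set (EuclideanSpace ℝ (Fin n)))
    (u : EuclideanSpace ℝ (Fin n) → ℝ) : KConvex k Ω u ↔ Admissible (coeffSet n k) Ω u := by
  simp only [KConvex, Admissible, finiteCone_coeffSet hk hkn, closedConeMat, Set.mem_ofPred_eq,
    mem_closure_gardingCone_iff hkn]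

lemma eventually_differentiableAt_and_fderiv {E F : Type*} [NormedAddCommGroup E]
    [NormedSpace ℝ E] [NormedAddCommGroup F] [NormedSpace ℝ F] {f : E → F} {x : E}
    (hf : ContDiffAt ℝ 2 f x) :
    (∀ᶠ y in 𝓝 x, DifferentiableAt ℝ f y) ∧ DifferentiableAt ℝ (fderiv ℝ f) x :=
  ⟨(hf.eventually (by simp)).mono fun _ hy => hy.differentiableAt two_ne_zero,
    (hf.fderiv_right (m := 1) one_add_one_eq_two.le).differentiableAt one_ne_zero⟩

end Operator

end KHessian

theorem lemma6p3_general (n k : ℕ) (hk : 2 ≤ k) (hkn : k ≤ n) :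
    (∀ (M : Matrix (Fin n) (Fin n) ℝ) (hM : M.IsHermitian),
      (hM.eigenvalues ∈ closure (KHessian.gardingCone n k) →
        KHessian.infOp (KHessian.coeffSet n k) M
          = (((k : ℝ) * (KHessian.sigma k hM.eigenvalues) ^ (1 / (k : ℝ)) : ℝ) : EReal)) ∧
      (hM.eigenvalues ∉ closure (KHessian.gardingCone n k) →
        KHessian.infOp (KHessian.coeffSet n k) M = ⊥)) ∧
    KHessian.finiteCone (KHessian.coeffSet n k) = KHessian.closedConeMat n k ∧
    (∀ (Ω : Set (EuclideanSpace ℝ (Fin n))) (u : EuclideanSpace ℝ (Fin n) → ℝ),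
      (∀ x ∈ Ω, (∀ᶠ y in nhds x, DifferentiableAt ℝ u y) ∧ DifferentiableAt ℝ (fderiv ℝ u) x) →
      (KHessian.KConvex k Ω u ↔ KHessian.Admissible (KHessian.coeffSet n k) Ω u)) :=
  ⟨fun _ hM => ⟨KHessian.infOp_coeffSet_of_mem (one_le_two.trans hk) hkn hM,
      KHessian.infOp_coeffSet_of_notMem hk hkn hM⟩,
    KHessian.finiteCone_coeffSet hk hkn, fun Ω u _ => KHessian.kConvex_iff_admissible hk hkn Ω u⟩

theorem lemma6p3 (n k : ℕ) (hk : 2 ≤ k) (hkn : k ≤ n) :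
    (∀ (M : Matrix (Fin n) (Fin n) ℝ) (hM : M.IsHermitian),
      (hM.eigenvalues ∈ closure (KHessian.gardingCone n k) →
        KHessian.infOp (KHessian.coeffSet n k) M
          = (((k : ℝ) * (KHessian.sigma k hM.eigenvalues) ^ (1 / (k : ℝ)) : ℝ) : EReal)) ∧
      (hM.eigenvalues ∉ closure (KHessian.gardingCone n k) →
        KHessian.infOp (KHessian.coeffSet n k) M = ⊥)) ∧
    KHessian.finiteCone (KHessian.coeffSet n k) = KHessian.closedConeMat n k ∧
    (∀ (Ω : Set (EuclideanSpace ℝ (Fin n))) (u : EuclideanSpace ℝ (Fin n) → ℝ),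
      IsOpen Ω → ContDiffOn ℝ 2 u Ω →
      (KHessian.KConvex k Ω u ↔ KHessian.Admissible (KHessian.coeffSet n k) Ω u)) :=
  have ⟨hinf, hcone, hadm⟩ := lemma6p3_general n k hk hkn
  ⟨hinf, hcone, fun Ω u hΩ hu => hadm Ω u fun _ hx =>
    KHessian.eventually_differentiableAt_and_fderiv (hu.contDiffAt (hΩ.mem_nhds hx))⟩
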